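/- Let $n\ge 1$ be an integer, $s>5/2$ real and $T\in(0,\infty]$. Let $u\in C([0,T);H^s(\mathbb{R}))\cap C^1([0,T);H^{s-1}(\mathbb{R}))$ be a real-valued strong solution of the generalized higher-order Camassa–Holm (HOCH) equation $$m_t+(u^2-u_x^2)^{n-1}u_x\,m+\partial_x\big[(u^2-u_x^2)^{n-1}u\,m\big]=0,\qquad m=u-u_{xx},$$ where the equation is understood, at every time $t\in[0,T)$, in the sense of distributions in $x\in\mathbb{R}$, and $u(t,\cdot)$ denotes the continuous representative. Then for every $t\in[0,T)$ the function $$u^{2n+1}+\sum_{k=1}^{n}\frac{(-1)^{k+1}}{2k-1}\binom{n}{k}u^{2n-2k+1}u_x^{2k}$$ is integrable on $\mathbb{R}$ at time $t$, and the functional $$H_2(u)=\int_{\mathbb{R}}\Big(u^{2n+1}+\sum_{k=1}^{n}\frac{(-1)^{k+1}}{2k-1}\binom{n}{k}u^{2n-2k+1}u_x^{2k}\Big)\,dx$$ is independent of time: $H_2(u(t,\cdot))=H_2(u(0,\cdot))$ for all $t\in[0,T)$. -/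

import Mathlib

open MeasureTheory TemperedDistribution
open scoped SchwartzMap ContDiff

noncomputable section

namespace HOCH

/-- The time interval `[0, T)`, where `T` may be `∞`. -/
def timeInterval (T : EReal) : Set ℝ := {t : ℝ | 0 ≤ t ∧ (t : EReal) < T}

/-- `t ↦ u t` belongs to `C^k(I; H^σ(ℝ))` (used with `σ ≥ 0`). The Bessel potential of order `σ` is
an isometric isomorphism of `H^σ` onto `L²`, so this says that each `u t` is an `L²` function
whose Bessel potential of order `σ` is some `F t ∈ L²`, and that the curve `F` is `C^k` on `I`
in the `L²` norm (with one-sided derivatives at an end point of `I`). -/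
def IsSobolevCurve (k : ℕ) (σ : ℝ) (I : Set ℝ) (u : ℝ → ℝ → ℝ) : Prop :=
  ∃ F : ℝ → Lp ℂ 2 (volume : Measure ℝ), ContDiffOn ℝ k F I ∧
    ∀ t ∈ I, ∃ h : MemLp (fun x : ℝ => (u t x : ℂ)) 2 volume,
      besselPotential ℝ ℂ σ (h.toLp (fun x : ℝ => (u t x : ℂ)) : 𝓢'(ℝ, ℂ)) = (F t : 𝓢'(ℝ, ℂ))

/-- The momentum density `m = f - f_xx`. -/
def momentum (f : ℝ → ℝ) (x : ℝ) : ℝ := f x - deriv (deriv f) x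

/-- Strong solutions `u ∈ C([0,T); H^s) ∩ C¹([0,T); H^(s-1))` of
`m_t + (u² - u_x²)^(n-1) u_x m + ∂_x [(u² - u_x²)^(n-1) u m] = 0`, `m = u - u_xx`. -/
structure IsStrongSolution (n : ℕ) (s : ℝ) (T : EReal) (u : ℝ → ℝ → ℝ) : Prop where
  /-- `u t` is the continuous representative of its class in `H^s`. -/
  continuous_space : ∀ t ∈ timeInterval T, Continuous (u t)
  continuous_Hs : IsSobolevCurve 0 s (timeInterval T) u
  contDiff_Hs_sub_one : IsSobolevCurve 1 (s - 1) (timeInterval T) u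
  /-- For `s < 3` the terms `m_t` and `∂_x [...]` are only distributions in `x` (elements of
  `H^(s-3)`), so the equation at time `t` is tested against smooth functions of `x` with compact
  support. -/
  equation : ∀ t ∈ timeInterval T, ∀ φ : ℝ → ℝ, ContDiff ℝ ∞ φ → HasCompactSupport φ →
    HasDerivWithinAt (fun τ => ∫ x, momentum (u τ) x * φ x)
      (-(∫ x, (u t x ^ 2 - deriv (u t) x ^ 2) ^ (n - 1) * deriv (u t) x * momentum (u t) x * φ x)
        + ∫ x, (u t x ^ 2 - deriv (u t) x ^ 2) ^ (n - 1) * u t x * momentum (u t) x * deriv φ x)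
      (timeInterval T) t

/-- The density of `H₂`. -/
def H2density (n : ℕ) (f : ℝ → ℝ) (x : ℝ) : ℝ :=
  f x ^ (2 * n + 1) + ∑ k ∈ Finset.Icc 1 n,
    (-1 : ℝ) ^ (k + 1) / (2 * (k : ℝ) - 1) * (n.choose k : ℝ)
      * f x ^ (2 * n - 2 * k + 1) * deriv f x ^ (2 * k)

/-- The functional `H₂`. -/
def H2 (n : ℕ) (f : ℝ → ℝ) : ℝ := ∫ x, H2density n f x

end HOCH

end

/-!
Write `p = u_x`, let `L(u, p)` be the density of `H₂`, and let `E = L_u - ∂ₓ (L_p)` be its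
variational derivative. Since `L - p L_p = u (u² - p²)^n`, the Beltrami identity
`p E = ∂ₓ (L - p L_p)` yields `E = (u² - p²)^n + 2n (u² - p²)^(n-1) u m`. As
`∂ₓ (u² - p²)^n = 2n (u² - p²)^(n-1) p m`, the equation says `m_t = -(2n)⁻¹ ∂ₓ E`: it is Hamiltonian
with skew-adjoint operator `∂ₓ (1 - ∂ₓ²)⁻¹`. So `v = u_t` satisfies `v - v'' = -(2n)⁻¹ E'`, that is,
`w = v' - (2n)⁻¹ E` has derivative `v`, and therefore
`(2n)⁻¹ dH₂/dt = ∫ (2n)⁻¹ E v = ∫ (v v' - w w') = 0`.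

For `s < 3` the second derivative of `v` exists only as a distribution, but the weak derivative `v`
of `w` is continuous, so `w` is `C¹`. Differentiation under the integral in `H₂` only needs
`t ↦ (u, u_x)` to be a differentiable curve in `L²` that is locally bounded in `L^∞`, because `L`
vanishes to second order at the origin.
-/

noncomputable section

namespace HOCH

open FourierTransform Real Filter Topology Convolution

theorem coeFn_toLp_smul {α F : Type*} [MeasurableSpace α] {μ : Measure α} [NormedAddCommGroup F]
    [NormedSpace ℂ F] {p q r : ENNReal} [p.HolderTriple q r] {a : α → ℂ} (ha : MemLp a p μ)
    (f : Lp F q μ) : (ha.toLp a • f : Lp F r μ) =ᵐ[μ] fun x => a x • f x := by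
  filter_upwards [Lp.coeFn_lpSMul (r := r) (ha.toLp a) f, ha.coeFn_toLp] with x h₁ h₂
  rw [h₁, Pi.smul_apply', h₂]

section FourierMultiplier

variable {V F : Type*} [NormedAddCommGroup V] [InnerProductSpace ℝ V]
  [NormedAddCommGroup F] [InnerProductSpace ℂ F]

theorem continuous_neg_innerₗ_uncurry : Continuous fun p : V × V => (-innerₗ V) p.1 p.2 := by
  simp only [LinearMap.neg_apply, innerₗ_apply_apply]
  fun_prop

variable [FiniteDimensional ℝ V] [MeasurableSpace V] [BorelSpace V]

theorem continuous_fourierInv_of_integrable {f : V → F} (hf : Integrable f) : Continuous (𝓕⁻ f) :=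
  VectorFourier.fourierIntegral_continuous (L := -innerₗ V) Real.continuous_fourierChar
    continuous_neg_innerₗ_uncurry hf

theorem norm_fourierInv_apply_le (f : V → F) (x : V) : ‖𝓕⁻ f x‖ ≤ ∫ ξ, ‖f ξ‖ :=
  VectorFourier.norm_fourierIntegral_le_integral_norm 𝐞 volume (-innerₗ V) f x

theorem integral_fourierInv_smul_eq [CompleteSpace F] {g : V → ℂ} {f : V → F} (hg : Integrable g)
    (hf : Integrable f) : ∫ ξ, 𝓕⁻ g ξ • f ξ = ∫ x, g x • 𝓕⁻ f x := by
  have h := VectorFourier.integral_fourierIntegral_smul_eq_flip (L := -innerₗ V)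
    Real.continuous_fourierChar continuous_neg_innerₗ_uncurry hg hf
  rwa [show (-innerₗ V).flip = -innerₗ V by ext x y; simp [real_inner_comm]] at h

theorem coeFn_fourierInv_of_integrable [CompleteSpace F] (f : Lp F 2 (volume : Measure V))
    (hf : Integrable f) : (𝓕⁻ f : Lp F 2 (volume : Measure V)) =ᵐ[volume] 𝓕⁻ (f : V → F) := by
  refine ae_eq_of_integral_contDiff_smul_eq ((Lp.memLp _).locallyIntegrable one_le_two)
    (continuous_fourierInv_of_integrable hf).locallyIntegrable fun g hg hgc => ?_
  have hcs : HasCompactSupport (Complex.ofRealCLM ∘ g) := hgc.comp_left rfl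
  have hsmooth : ContDiff ℝ ∞ (Complex.ofRealCLM ∘ g) := by fun_prop
  have hadjoint : ((𝓕⁻ f : Lp F 2 (volume : Measure V)) : 𝓢'(V, F)) (hcs.toSchwartzMap hsmooth) =
      (f : 𝓢'(V, F)) (𝓕⁻ (hcs.toSchwartzMap hsmooth)) := by
    rw [← Lp.fourierInv_toTemperedDistribution_eq]; rfl
  simp only [Lp.toTemperedDistribution_apply, SchwartzMap.fourierInv_coe] at hadjoint
  have hflip := integral_fourierInv_smul_eq
    (hsmooth.continuous.integrable_of_hasCompactSupport hcs) hf
  exact hadjoint.trans hflip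

theorem hasDerivAt_fourierInv {f : ℝ → F} (hf : Integrable f)
    (hf' : Integrable fun ξ : ℝ => (2 * π * Complex.I * ξ) • f ξ) (x : ℝ) :
    HasDerivAt (𝓕⁻ f) (𝓕⁻ (fun ξ : ℝ => (2 * π * Complex.I * ξ) • f ξ) x) x := by
  have hmul : Integrable (fun ξ : ℝ => ξ • f ξ) := by
    refine (hf'.smul (2 * π * Complex.I)⁻¹).congr (Eventually.of_forall fun ξ => ?_)
    rw [Pi.smul_apply, smul_smul, inv_mul_cancel_left₀ Complex.two_pi_I_ne_zero, Complex.coe_smul]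
  have hneg := (hasDerivAt_fourier hf hmul (-x)).scomp x (hasDerivAt_neg x)
  rw [show 𝓕⁻ f = 𝓕 f ∘ Neg.neg from funext (fourierInv_eq_fourier_neg f),
    fourierInv_eq_fourier_neg]
  convert! hneg using 1
  rw [Real.fourier_eq, Real.fourier_eq, ← integral_smul]
  refine integral_congr_ae (Eventually.of_forall fun ξ => ?_)
  simp only [neg_smul, one_smul, smul_neg, neg_mul, neg_neg]

variable [CompleteSpace F]

/-- The Fourier multiplier `G ↦ 𝓕⁻¹ (a • 𝓕 G)` with bounded symbol `a`, as an operator on `L²`. -/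
def fourierMultiplierL2 (a : Lp ℂ ⊤ (volume : Measure V)) :
    Lp F 2 (volume : Measure V) →L[ℂ] Lp F 2 (volume : Measure V) :=
  ((Lp.fourierTransformₗᵢ V F).symm : Lp F 2 (volume : Measure V) →L[ℂ] Lp F 2 volume) ∘L
    ((ContinuousLinearMap.lsmul ℂ ℂ).holderL volume ⊤ 2 2 a) ∘L
    ((Lp.fourierTransformₗᵢ V F) : Lp F 2 (volume : Measure V) →L[ℂ] Lp F 2 volume)

theorem fourierMultiplierL2_apply (a : Lp ℂ ⊤ (volume : Measure V))
    (G : Lp F 2 (volume : Measure V)) :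
    fourierMultiplierL2 a G = 𝓕⁻ (a • (𝓕 G : Lp F 2 (volume : Measure V)) : Lp F 2 volume) := rfl

/-- The function `𝓕⁻¹ (a • 𝓕 G)` given by the inverse Fourier integral; for a symbol `a ∈ L²` the
integrand is in `L¹`, so that its values at points make sense. -/
def fourierMultiplierFun (a : V → ℂ) (G : Lp F 2 (volume : Measure V)) : V → F :=
  𝓕⁻ fun ξ => a ξ • (𝓕 G : Lp F 2 (volume : Measure V)) ξ

theorem integrable_smul_fourier {a : V → ℂ} (ha : MemLp a 2) (G : Lp F 2 (volume : Measure V)) :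
    Integrable fun ξ => a ξ • (𝓕 G : Lp F 2 (volume : Measure V)) ξ :=
  memLp_one_iff_integrable.1 ((Lp.memLp (𝓕 G : Lp F 2 (volume : Measure V))).smul ha)

theorem continuous_fourierMultiplierFun {a : V → ℂ} (ha : MemLp a 2)
    (G : Lp F 2 (volume : Measure V)) : Continuous (fourierMultiplierFun a G) :=
  continuous_fourierInv_of_integrable (integrable_smul_fourier ha G)

theorem coeFn_fourierMultiplierL2 {a : V → ℂ} (ha : MemLp a ⊤) (ha₂ : MemLp a 2)
    (G : Lp F 2 (volume : Measure V)) :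
    fourierMultiplierL2 (ha.toLp a) G =ᵐ[volume] fourierMultiplierFun a G := by
  have hsmul := coeFn_toLp_smul (r := 2) ha (𝓕 G : Lp F 2 (volume : Measure V))
  rw [fourierMultiplierL2_apply]
  refine (coeFn_fourierInv_of_integrable _
    ((integrable_smul_fourier ha₂ G).congr hsmul.symm)).trans ?_
  exact Eventually.of_forall fun x => fourierInv_congr_ae hsmul x

theorem norm_fourierMultiplierFun_le {a : V → ℂ} (ha : MemLp a 2)
    (G : Lp F 2 (volume : Measure V)) (x : V) :
    ‖fourierMultiplierFun a G x‖ ≤ ‖ha.toLp a‖ * ‖G‖ := by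
  calc ‖fourierMultiplierFun a G x‖
      ≤ ∫ ξ, ‖a ξ • (𝓕 G : Lp F 2 (volume : Measure V)) ξ‖ := norm_fourierInv_apply_le _ x
    _ = ‖(ha.toLp a • (𝓕 G : Lp F 2 (volume : Measure V)) : Lp F 1 (volume : Measure V))‖ := by
        rw [L1.norm_eq_integral_norm]
        exact integral_congr_ae ((coeFn_toLp_smul ha _).symm.fun_comp norm)
    _ ≤ ‖ha.toLp a‖ * ‖(𝓕 G : Lp F 2 (volume : Measure V))‖ := Lp.norm_smul_le _ _
    _ = ‖ha.toLp a‖ * ‖G‖ := by rw [Lp.norm_fourier_eq]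

theorem hasDerivAt_fourierMultiplierFun {a : ℝ → ℂ} (ha : MemLp a 2)
    (ha' : MemLp (fun ξ : ℝ => 2 * π * Complex.I * ξ * a ξ) 2) (G : Lp F 2 (volume : Measure ℝ))
    (x : ℝ) :
    HasDerivAt (fourierMultiplierFun a G)
      (fourierMultiplierFun (fun ξ : ℝ => 2 * π * Complex.I * ξ * a ξ) G x) x := by
  have hderiv := integrable_smul_fourier ha' G
  simp only [mul_smul _ (a _)] at hderiv
  simpa only [fourierMultiplierFun, mul_smul _ (a _)] using
    hasDerivAt_fourierInv (integrable_smul_fourier ha G) hderiv x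

end FourierMultiplier

section BesselSymbol

variable {σ : ℝ} {j : ℕ}

/-- The symbol `(2πiξ)ʲ (1 + ξ²)^(-σ/2)` of `∂ʲ` composed with the Bessel potential of order
`-σ`. -/
def besselSymbol (σ : ℝ) (j : ℕ) (ξ : ℝ) : ℂ :=
  (2 * π * Complex.I * ξ) ^ j * ((1 + ‖ξ‖ ^ 2) ^ (-σ / 2) : ℝ)

theorem besselSymbol_zero (σ : ℝ) :
    besselSymbol σ 0 = fun ξ : ℝ => (((1 + ‖ξ‖ ^ 2) ^ (-σ / 2) : ℝ) : ℂ) := by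
  ext ξ
  rw [besselSymbol, pow_zero, one_mul]

theorem besselSymbol_succ (σ : ℝ) (j : ℕ) :
    besselSymbol σ (j + 1) = fun ξ : ℝ => 2 * π * Complex.I * ξ * besselSymbol σ j ξ := by
  ext ξ
  rw [besselSymbol, besselSymbol, pow_succ', mul_assoc]

theorem continuous_besselSymbol (σ : ℝ) (j : ℕ) : Continuous (besselSymbol σ j) := by
  have : Continuous fun ξ : ℝ => (1 + ‖ξ‖ ^ 2) ^ (-σ / 2) :=
    Continuous.rpow_const (by fun_prop) fun ξ => Or.inl (by positivity)
  unfold besselSymbol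
  fun_prop

theorem norm_besselSymbol_le (σ : ℝ) (j : ℕ) (ξ : ℝ) :
    ‖besselSymbol σ j ξ‖ ≤ (2 * π) ^ j * (1 + ‖ξ‖ ^ 2) ^ (-(σ - j) / 2) := by
  have hpow : ‖ξ‖ ^ j ≤ (1 + ‖ξ‖ ^ 2) ^ ((j : ℝ) / 2) := by
    calc ‖ξ‖ ^ j = (‖ξ‖ ^ 2) ^ ((j : ℝ) / 2) := by
          rw [← rpow_natCast_mul (norm_nonneg ξ), Nat.cast_ofNat, mul_div_cancel₀ _ two_ne_zero,
            rpow_natCast]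
      _ ≤ (1 + ‖ξ‖ ^ 2) ^ ((j : ℝ) / 2) := by gcongr; linarith
  calc ‖besselSymbol σ j ξ‖ = (2 * π) ^ j * (‖ξ‖ ^ j * (1 + ‖ξ‖ ^ 2) ^ (-σ / 2)) := by
        rw [besselSymbol, norm_mul, norm_pow, Complex.norm_of_nonneg (by positivity), ← mul_assoc,
          ← mul_pow]
        simp [abs_of_pos pi_pos]
    _ ≤ (2 * π) ^ j * ((1 + ‖ξ‖ ^ 2) ^ ((j : ℝ) / 2) * (1 + ‖ξ‖ ^ 2) ^ (-σ / 2)) := by gcongr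
    _ = (2 * π) ^ j * (1 + ‖ξ‖ ^ 2) ^ (-(σ - j) / 2) := by
        rw [← rpow_add (by positivity)]; ring_nf

theorem memLp_top_besselSymbol (h : j ≤ σ) : MemLp (besselSymbol σ j) ⊤ volume := by
  refine memLp_top_of_bound (continuous_besselSymbol σ j).aestronglyMeasurable ((2 * π) ^ j)
    (Eventually.of_forall fun ξ => (norm_besselSymbol_le σ j ξ).trans ?_)
  refine mul_le_of_le_one_right (by positivity) ?_
  exact rpow_le_one_of_one_le_of_nonpos (by simp [sq_nonneg]) (by linarith)

theorem memLp_two_besselSymbol (h : j + 1 / 2 < σ) : MemLp (besselSymbol σ j) 2 volume := by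
  rw [memLp_two_iff_integrable_sq_norm (continuous_besselSymbol σ j).aestronglyMeasurable]
  have hdom : Integrable fun ξ : ℝ => (1 + ‖ξ‖ ^ 2) ^ (-(2 * (σ - j)) / 2) :=
    integrable_rpow_neg_one_add_norm_sq (by simp; linarith)
  refine (hdom.const_mul (((2 * π) ^ j) ^ 2)).mono'
    ((continuous_besselSymbol σ j).norm.pow 2).aestronglyMeasurable
    (Eventually.of_forall fun ξ => ?_)
  rw [norm_pow, norm_norm]
  calc ‖besselSymbol σ j ξ‖ ^ 2 ≤ ((2 * π) ^ j * (1 + ‖ξ‖ ^ 2) ^ (-(σ - j) / 2)) ^ 2 := by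
        gcongr; exact norm_besselSymbol_le σ j ξ
    _ = ((2 * π) ^ j) ^ 2 * (1 + ‖ξ‖ ^ 2) ^ (-(2 * (σ - j)) / 2) := by
        rw [mul_pow, ← rpow_mul_natCast (by positivity)]
        push_cast
        ring_nf

theorem hasTemperateGrowth_besselSymbol_zero (σ : ℝ) : (besselSymbol σ 0).HasTemperateGrowth := by
  rw [besselSymbol_zero]
  fun_prop

/-- The Bessel potential of order `σ` is inverted by the multiplier with symbol `⟨ξ⟩^(-σ)`. -/
theorem eq_fourierMultiplierL2_of_besselPotential_eq (hσ : 0 ≤ σ)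
    {f F : Lp ℂ 2 (volume : Measure ℝ)}
    (h : besselPotential ℝ ℂ σ (f : 𝓢'(ℝ, ℂ)) = (F : 𝓢'(ℝ, ℂ))) :
    f = fourierMultiplierL2
      ((memLp_top_besselSymbol (σ := σ) (j := 0) (by simpa using hσ)).toLp _) F := by
  apply LinearMap.ker_eq_bot.1 (Lp.ker_toTemperedDistributionCLM_eq_bot (F := ℂ) (p := 2)
    (μ := (volume : Measure ℝ)))
  have hinv : besselPotential ℝ ℂ (-σ) (F : 𝓢'(ℝ, ℂ)) = (f : 𝓢'(ℝ, ℂ)) :=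
    (besselPotential_neg_apply_eq_iff σ _ _).2 h
  change (f : 𝓢'(ℝ, ℂ)) = (fourierMultiplierL2 _ F : Lp ℂ 2 (volume : Measure ℝ))
  rw [← hinv, besselPotential, TemperedDistribution.fourierMultiplierCLM_apply,
    Lp.fourier_toTemperedDistribution_eq, ← besselSymbol_zero,
    ← Lp.toTemperedDistribution_smul_eq (p := ⊤) (r := 2) (hasTemperateGrowth_besselSymbol_zero σ)
      (memLp_top_besselSymbol (by simpa using hσ)), Lp.fourierInv_toTemperedDistribution_eq,
    fourierMultiplierL2_apply]

end BesselSymbol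

section SobolevRep

variable {σ : ℝ} {j : ℕ}

/-- The real part of `∂ʲ ⟨D⟩^(-σ) G` as a function on `ℝ`: for `f ∈ H^σ` with Bessel potential `G`
this is the continuous representative of the `j`-th derivative of `f`, provided `j + 1/2 < σ`. -/
def sobolevRep (σ : ℝ) (j : ℕ) (G : Lp ℂ 2 (volume : Measure ℝ)) (x : ℝ) : ℝ :=
  (fourierMultiplierFun (besselSymbol σ j) G x).re

/-- The real part of `∂ʲ ⟨D⟩^(-σ) G`, as an operator on `L²`. -/
def sobolevL2 (σ : ℝ) (j : ℕ) (h : j ≤ σ) :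
    Lp ℂ 2 (volume : Measure ℝ) →L[ℝ] Lp ℝ 2 (volume : Measure ℝ) :=
  (Complex.reCLM.compLpL 2 volume) ∘L
    (fourierMultiplierL2 ((memLp_top_besselSymbol h).toLp _)).restrictScalars ℝ

theorem coeFn_sobolevL2 (h : j ≤ σ) (h' : j + 1 / 2 < σ) (G : Lp ℂ 2 (volume : Measure ℝ)) :
    sobolevL2 σ j h G =ᵐ[volume] sobolevRep σ j G :=
  (Complex.reCLM.coeFn_compLpL _).trans ((coeFn_fourierMultiplierL2 (memLp_top_besselSymbol h)
    (memLp_two_besselSymbol h') G).fun_comp Complex.re)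

theorem memLp_sobolevRep (h : j + 1 / 2 < σ) (G : Lp ℂ 2 (volume : Measure ℝ)) :
    MemLp (sobolevRep σ j G) 2 volume :=
  (memLp_congr_ae (coeFn_sobolevL2 (by linarith) h G)).1 (Lp.memLp _)

theorem continuous_sobolevRep (h : j + 1 / 2 < σ) (G : Lp ℂ 2 (volume : Measure ℝ)) :
    Continuous (sobolevRep σ j G) :=
  Complex.continuous_re.comp (continuous_fourierMultiplierFun (memLp_two_besselSymbol h) G)

theorem exists_norm_sobolevRep_le (h : j + 1 / 2 < σ) :
    ∃ C : ℝ, ∀ (G : Lp ℂ 2 (volume : Measure ℝ)) (x : ℝ), ‖sobolevRep σ j G x‖ ≤ C * ‖G‖ :=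
  ⟨_, fun G x => (Complex.abs_re_le_norm _).trans
    (norm_fourierMultiplierFun_le (memLp_two_besselSymbol h) G x)⟩

theorem hasDerivAt_sobolevRep (h : j + 3 / 2 < σ) (G : Lp ℂ 2 (volume : Measure ℝ)) (x : ℝ) :
    HasDerivAt (sobolevRep σ j G) (sobolevRep σ (j + 1) G x) x := by
  have hsucc := memLp_two_besselSymbol (σ := σ) (j := j + 1) (by push_cast; linarith)
  have hderiv := hasDerivAt_fourierMultiplierFun (memLp_two_besselSymbol (σ := σ) (j := j)
    (by linarith)) (besselSymbol_succ σ j ▸ hsucc) G x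
  rw [← besselSymbol_succ] at hderiv
  exact Complex.reCLM.hasFDerivAt.comp_hasDerivAt x hderiv

theorem deriv_sobolevRep (h : j + 3 / 2 < σ) (G : Lp ℂ 2 (volume : Measure ℝ)) :
    deriv (sobolevRep σ j G) = sobolevRep σ (j + 1) G :=
  funext fun x => (hasDerivAt_sobolevRep h G x).deriv

theorem contDiff_sobolevRep {k : ℕ} (h : j + k + 1 / 2 < σ) (G : Lp ℂ 2 (volume : Measure ℝ)) :
    ContDiff ℝ k (sobolevRep σ j G) := by
  induction k generalizing j with
  | zero => exact contDiff_zero.2 (continuous_sobolevRep (by simpa using h) G)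
  | succ k ih =>
    push_cast at h
    have hj : j + 3 / 2 < σ := by linarith [(k.cast_nonneg : (0 : ℝ) ≤ k)]
    rw [Nat.cast_succ, contDiff_succ_iff_deriv, deriv_sobolevRep hj]
    exact ⟨fun x => (hasDerivAt_sobolevRep hj G x).differentiableAt, by simp,
      ih (by push_cast; linarith)⟩

theorem eq_sobolevRep_of_besselPotential_eq (hσ : 1 / 2 < σ) {f : ℝ → ℝ} (hf : Continuous f)
    (hf₂ : MemLp (fun x : ℝ => (f x : ℂ)) 2 volume) {G : Lp ℂ 2 (volume : Measure ℝ)}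
    (hG : besselPotential ℝ ℂ σ (hf₂.toLp (fun x : ℝ => (f x : ℂ)) : 𝓢'(ℝ, ℂ)) =
      (G : 𝓢'(ℝ, ℂ))) :
    f = sobolevRep σ 0 G := by
  have hσ' : (0 : ℕ) + 1 / 2 < σ := by simpa using hσ
  have hrep := coeFn_fourierMultiplierL2
    (memLp_top_besselSymbol (σ := σ) (j := 0) (by rw [Nat.cast_zero]; linarith))
    (memLp_two_besselSymbol hσ') G
  rw [← eq_fourierMultiplierL2_of_besselPotential_eq (by linarith) hG] at hrep
  refine (Continuous.ae_eq_iff_eq volume hf (continuous_sobolevRep hσ' G)).1 ?_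
  filter_upwards [hf₂.coeFn_toLp, hrep] with x h₁ h₂
  rw [sobolevRep, ← h₂, h₁, Complex.ofReal_re]

end SobolevRep

section WeakDeriv

variable {F : Type*} [NormedAddCommGroup F] [NormedSpace ℝ F] {w v : ℝ → F}

/-- `v` is the derivative of `w` in the sense of distributions on `ℝ`. Only used for `w` and `v`
locally integrable: otherwise the integrals may take the junk value `0`. -/
def HasWeakDeriv (w v : ℝ → F) : Prop :=
  ∀ φ : ℝ → ℝ, ContDiff ℝ ∞ φ → HasCompactSupport φ → ∫ x, deriv φ x • w x = -∫ x, φ x • v x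

theorem integrable_testFunction_smul {φ : ℝ → ℝ} (hφ : Continuous φ) (hφc : HasCompactSupport φ)
    (hv : Continuous v) : Integrable fun x => φ x • v x :=
  (hφ.smul hv).integrable_of_hasCompactSupport hφc.smul_right

theorem HasWeakDeriv.of_hasDerivAt (hw : ∀ x, HasDerivAt w (v x) x) (hv : Continuous v) :
    HasWeakDeriv w v := fun φ hφ hφc => by
  have hwc : Continuous w := continuous_iff_continuousAt.2 fun x => (hw x).continuousAt
  have hφ' : Continuous (deriv φ) := hφ.continuous_deriv (by simp)
  have hparts := integral_bilinear_hasDerivAt_right_eq_neg_left_of_integrable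
    (L := ContinuousLinearMap.lsmul ℝ ℝ) (u := φ) (v := w)
    (fun x _ => (hφ.differentiable (by simp) x).hasDerivAt) (fun x _ => hw x)
    (integrable_testFunction_smul hφ.continuous hφc hv)
    (integrable_testFunction_smul hφ' hφc.deriv hwc)
    (integrable_testFunction_smul hφ.continuous hφc hwc)
  simpa only [ContinuousLinearMap.lsmul_apply, neg_neg] using (congrArg Neg.neg hparts).symm

theorem HasWeakDeriv.sub {w₁ v₁ w₂ v₂ : ℝ → F} (h₁ : HasWeakDeriv w₁ v₁)
    (h₂ : HasWeakDeriv w₂ v₂) (hw₁ : Continuous w₁) (hv₁ : Continuous v₁) (hw₂ : Continuous w₂)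
    (hv₂ : Continuous v₂) : HasWeakDeriv (w₁ - w₂) (v₁ - v₂) := fun φ hφ hφc => by
  have hφ' : Continuous (deriv φ) := hφ.continuous_deriv (by simp)
  simp only [Pi.sub_apply, smul_sub]
  rw [integral_sub (integrable_testFunction_smul hφ' hφc.deriv hw₁)
      (integrable_testFunction_smul hφ' hφc.deriv hw₂),
    integral_sub (integrable_testFunction_smul hφ.continuous hφc hv₁)
      (integrable_testFunction_smul hφ.continuous hφc hv₂), h₁ φ hφ hφc, h₂ φ hφ hφc]
  abel

/-- Mollifications of `w` have derivative zero, and converge pointwise to `w`. -/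
theorem HasWeakDeriv.eq_of_zero [CompleteSpace F] (h : HasWeakDeriv w 0) (hw : Continuous w)
    (x y : ℝ) : w x = w y := by
  let ρ : ℕ → ContDiffBump (0 : ℝ) := fun k =>
    ⟨1 / (k + 1 : ℝ) / 2, 1 / (k + 1 : ℝ), by positivity, half_lt_self (by positivity)⟩
  let mollified : ℕ → ℝ → F := fun k =>
    (ρ k).normed volume ⋆[ContinuousLinearMap.lsmul ℝ ℝ, volume] w
  have hderiv (k : ℕ) (z : ℝ) : HasDerivAt (mollified k) 0 z := by
    have hconv := HasCompactSupport.hasDerivAt_convolution_left (μ := volume)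
      (ContinuousLinearMap.lsmul ℝ ℝ) (ρ k).hasCompactSupport_normed
      ((ρ k).contDiff_normed (μ := volume)) hw.locallyIntegrable z
    rw [convolution_lsmul_swap] at hconv
    have htest := h (fun t => (ρ k).normed volume (z - t))
      ((ρ k).contDiff_normed.comp (contDiff_const.sub contDiff_id))
      ((ρ k).hasCompactSupport_normed.comp_homeomorph (Homeomorph.subLeft z))
    simp only [deriv_comp_const_sub, neg_smul, integral_neg, Pi.zero_apply, smul_zero,
      integral_zero, neg_zero, neg_eq_zero] at htest
    rwa [htest] at hconv
  have hconst (k : ℕ) : mollified k x = mollified k y :=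
    is_const_of_deriv_eq_zero (fun z => (hderiv k z).differentiableAt) (fun z => (hderiv k z).deriv)
      x y
  have hlim (z : ℝ) : Tendsto (fun k => mollified k z) atTop (𝓝 (w z)) :=
    ContDiffBump.convolution_tendsto_right_of_continuous tendsto_one_div_add_atTop_nhds_zero_nat
      hw z
  exact tendsto_nhds_unique (hlim x) (by simpa only [hconst] using hlim y)

theorem HasWeakDeriv.hasDerivAt [CompleteSpace F] (h : HasWeakDeriv w v) (hw : Continuous w)
    (hv : Continuous v) (x : ℝ) : HasDerivAt w (v x) x := by
  have hprim (y : ℝ) : HasDerivAt (fun y => ∫ t in (0 : ℝ)..y, v t) (v y) y :=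
    intervalIntegral.integral_hasDerivAt_right (hv.intervalIntegrable 0 y)
      hv.stronglyMeasurable.stronglyMeasurableAtFilter hv.continuousAt
  have hprimc : Continuous fun y => ∫ t in (0 : ℝ)..y, v t :=
    continuous_iff_continuousAt.2 fun y => (hprim y).continuousAt
  have hzero : HasWeakDeriv (w - fun y => ∫ t in (0 : ℝ)..y, v t) 0 := by
    simpa only [sub_self] using h.sub (.of_hasDerivAt hprim hv) hw hv hprimc hv
  refine ((hprim x).add_const (w 0)).congr_of_eventuallyEq (Eventually.of_forall fun y => ?_)
  simpa [sub_eq_iff_eq_add'] using hzero.eq_of_zero (hw.sub hprimc) y 0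

theorem integral_mul_deriv_self_eq_zero {f f' : ℝ → ℝ} (hf : ∀ x, HasDerivAt f (f' x) x)
    (hf₂ : MemLp f 2) (hf'₂ : MemLp f' 2) : ∫ x, f x * f' x = 0 := by
  have hparts := integral_mul_deriv_eq_deriv_mul_of_integrable (fun x _ => hf x) (fun x _ => hf x)
    (hf₂.integrable_mul hf'₂) (hf'₂.integrable_mul hf₂) (hf₂.integrable_mul hf₂)
  simp only [mul_comm (f' _)] at hparts
  exact self_eq_neg.1 hparts

/-- The function `w = v' - E` has derivative `v`, and `E v = v v' - w w'`. -/
theorem integral_mul_eq_zero_of_hasWeakDeriv {v E : ℝ → ℝ} (hv : ContDiff ℝ 1 v)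
    (hE : Continuous E) (hv₂ : MemLp v 2) (hv'₂ : MemLp (deriv v) 2) (hE₂ : MemLp E 2)
    (h : HasWeakDeriv (deriv v - E) v) : ∫ x, E x * v x = 0 := by
  have hw := h.hasDerivAt ((hv.continuous_deriv le_rfl).sub hE) hv.continuous
  have hw₂ := hv'₂.sub hE₂
  calc ∫ x, E x * v x = ∫ x, (v x * deriv v x - (deriv v - E) x * v x) := by
        exact integral_congr_ae (Eventually.of_forall fun x => by simp only [Pi.sub_apply]; ring)
    _ = 0 := by
        have hsub := integral_sub (hv₂.integrable_mul hv'₂) (hw₂.integrable_mul hv₂)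
        simp only [Pi.mul_apply] at hsub
        rw [hsub, integral_mul_deriv_self_eq_zero
            (fun x => (hv.differentiable one_ne_zero x).hasDerivAt) hv₂ hv'₂,
          integral_mul_deriv_self_eq_zero hw hw₂ hv₂, sub_zero]

end WeakDeriv

section IntegralFunctional

theorem norm_sq_eq_integral_norm_sq {α E : Type*} [MeasurableSpace α] {μ : Measure α}
    [NormedAddCommGroup E] (Y : Lp E 2 μ) : ‖Y‖ ^ 2 = ∫ x, ‖Y x‖ ^ 2 ∂μ := by
  rw [Lp.norm_def, toReal_eLpNorm (Lp.memLp Y).1,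
    lpNorm_eq_integral_norm_rpow_toReal two_ne_zero ENNReal.ofNat_ne_top (Lp.memLp Y).1,
    ← Real.rpow_mul_natCast (integral_nonneg fun x => by positivity)]
  simp

variable {α E F : Type*} [MeasurableSpace α] {μ : Measure α} [NormedAddCommGroup E]
  [NormedSpace ℝ E] [NormedAddCommGroup F] [NormedSpace ℝ F] {P : E → F} {s : Set E} {K : NNReal}

theorem norm_sub_sub_fderiv_le_of_lipschitzOnWith (hP : Differentiable ℝ P) (hs : Convex ℝ s)
    (hK : LipschitzOnWith K (fderiv ℝ P) s) {x y : E} (hx : x ∈ s) (hy : y ∈ s) :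
    ‖P y - P x - fderiv ℝ P x (y - x)‖ ≤ K * ‖y - x‖ ^ 2 := by
  have hseg (z : E) (hz : z ∈ segment ℝ x y) : ‖fderiv ℝ P z - fderiv ℝ P x‖ ≤ K * ‖y - x‖ :=
    (hK.norm_sub_le (hs.segment_subset hx hy hz) hx).trans
      (mul_le_mul_of_nonneg_left (norm_sub_le_of_mem_segment hz) K.coe_nonneg)
  calc ‖P y - P x - fderiv ℝ P x (y - x)‖ ≤ K * ‖y - x‖ * ‖y - x‖ :=
        (convex_segment x y).norm_image_sub_le_of_norm_hasFDerivWithin_le'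
          (fun z _ => (hP z).hasFDerivAt.hasFDerivWithinAt) hseg (left_mem_segment ℝ x y)
          (right_mem_segment ℝ x y)
    _ = K * ‖y - x‖ ^ 2 := by ring

theorem exists_lipschitzOnWith_fderiv_closedBall {E F : Type*} [NormedAddCommGroup E]
    [NormedSpace ℝ E] [ProperSpace E] [NormedAddCommGroup F] [NormedSpace ℝ F] {P : E → F}
    (hP : ContDiff ℝ 2 P) (R : ℝ) :
    ∃ K, LipschitzOnWith K (fderiv ℝ P) (Metric.closedBall 0 R) :=
  (hP.fderiv_right (m := 1) (by norm_num)).contDiffOn.exists_lipschitzOnWith one_ne_zero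
    (convex_closedBall 0 R) (isCompact_closedBall 0 R)

theorem memLp_fderiv_comp (hP : ContDiff ℝ 1 P) (hK : LipschitzOnWith K (fderiv ℝ P) s)
    (hs₀ : 0 ∈ s) (hP'₀ : fderiv ℝ P 0 = 0) {p : ENNReal} {z : α → E} (hz : MemLp z p μ)
    (hzs : ∀ᵐ x ∂μ, z x ∈ s) : MemLp (fun x => fderiv ℝ P (z x)) p μ := by
  refine hz.of_le_mul (c := K)
    ((hP.continuous_fderiv one_ne_zero).comp_aestronglyMeasurable hz.1) ?_
  filter_upwards [hzs] with x hx
  simpa only [hP'₀, sub_zero] using hK.norm_sub_le hx hs₀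

theorem integrable_comp_of_fderiv_zero (hP : Differentiable ℝ P) (hs : Convex ℝ s)
    (hK : LipschitzOnWith K (fderiv ℝ P) s) (hs₀ : 0 ∈ s) (hP₀ : P 0 = 0)
    (hP'₀ : fderiv ℝ P 0 = 0) {z : α → E} (hz : MemLp z 2 μ) (hzs : ∀ᵐ x ∂μ, z x ∈ s) :
    Integrable (fun x => P (z x)) μ := by
  refine (((memLp_two_iff_integrable_sq_norm hz.1).1 hz).const_mul (K : ℝ)).mono'
    (hP.continuous.comp_aestronglyMeasurable hz.1) ?_
  filter_upwards [hzs] with x hx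
  simpa [hP₀, hP'₀] using norm_sub_sub_fderiv_le_of_lipschitzOnWith hP hs hK hs₀ hx

variable [CompleteSpace F]

/-- Integration against an `L²` family of linear maps, `Y ↦ ∫ g x (Y x) ∂μ`. -/
def integralApplyCLM {g : α → E →L[ℝ] F} (hg : MemLp g 2 μ) : Lp E 2 μ →L[ℝ] F :=
  (ContinuousLinearMap.id ℝ (E →L[ℝ] F)).lpPairing μ 2 2 (hg.toLp g)

theorem integralApplyCLM_apply {g : α → E →L[ℝ] F} (hg : MemLp g 2 μ) (Y : Lp E 2 μ) :
    integralApplyCLM hg Y = ∫ x, g x (Y x) ∂μ := by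
  rw [integralApplyCLM, ContinuousLinearMap.lpPairing_eq_integral]
  refine integral_congr_ae ?_
  filter_upwards [hg.coeFn_toLp] with x hx
  rw [hx, ContinuousLinearMap.id_apply]

/-- By Taylor's estimate the remainder is at most `K ‖Z - Z₀‖²`. -/
theorem hasFDerivWithinAt_integral_comp (hP : ContDiff ℝ 1 P) (hs : Convex ℝ s)
    (hK : LipschitzOnWith K (fderiv ℝ P) s) (hs₀ : 0 ∈ s) (hP₀ : P 0 = 0)
    (hP'₀ : fderiv ℝ P 0 = 0) {Z₀ : Lp E 2 μ} (hZ₀ : ∀ᵐ x ∂μ, Z₀ x ∈ s) :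
    HasFDerivWithinAt (fun Z : Lp E 2 μ => ∫ x, P (Z x) ∂μ)
      (integralApplyCLM (memLp_fderiv_comp hP hK hs₀ hP'₀ (Lp.memLp Z₀) hZ₀))
      {Z | ∀ᵐ x ∂μ, Z x ∈ s} Z₀ := by
  have hg := memLp_fderiv_comp hP hK hs₀ hP'₀ (Lp.memLp Z₀) hZ₀
  have hdiff := hP.differentiable one_ne_zero
  have hint {Z : Lp E 2 μ} (hZ : ∀ᵐ x ∂μ, Z x ∈ s) : Integrable (fun x => P (Z x)) μ :=
    integrable_comp_of_fderiv_zero hdiff hs hK hs₀ hP₀ hP'₀ (Lp.memLp Z) hZ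
  have hremainder (Z : Lp E 2 μ) (hZ : ∀ᵐ x ∂μ, Z x ∈ s) :
      ‖(∫ x, P (Z x) ∂μ) - ∫ x, P (Z₀ x) ∂μ - integralApplyCLM hg (Z - Z₀)‖ ≤
        K * ‖‖Z - Z₀‖ ^ 2‖ := by
    have hlin : Integrable (fun x => fderiv ℝ P (Z₀ x) ((Z - Z₀) x)) μ :=
      memLp_one_iff_integrable.1 <| (ContinuousLinearMap.id ℝ (E →L[ℝ] F)).memLp_of_bilin
        (p := 2) (q := 2) 1 hg (Lp.memLp (Z - Z₀))
    have hsq : Integrable (fun x => ‖(Z - Z₀) x‖ ^ 2) μ :=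
      (memLp_two_iff_integrable_sq_norm (Lp.memLp _).1).1 (Lp.memLp (Z - Z₀))
    have hdiffint : Integrable (fun x => P (Z x) - P (Z₀ x)) μ := (hint hZ).sub (hint hZ₀)
    rw [integralApplyCLM_apply, ← integral_sub (hint hZ) (hint hZ₀),
      ← integral_sub hdiffint hlin, norm_pow, norm_norm,
      norm_sq_eq_integral_norm_sq, ← integral_const_mul]
    refine norm_integral_le_of_norm_le (hsq.const_mul (K : ℝ)) ?_
    filter_upwards [hZ, hZ₀, Lp.coeFn_sub Z Z₀] with x hx hx₀ hsub
    rw [hsub]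
    exact norm_sub_sub_fderiv_le_of_lipschitzOnWith hdiff hs hK hx₀ hx
  refine .of_isLittleO ((Asymptotics.IsBigO.of_bound (K : ℝ) ?_).trans_isLittleO
    ((Asymptotics.isLittleO_pow_sub_sub Z₀ one_lt_two).mono nhdsWithin_le_nhds))
  exact eventually_nhdsWithin_of_forall hremainder

theorem hasDerivWithinAt_integral_comp (hP : ContDiff ℝ 1 P) (hs : Convex ℝ s)
    (hK : LipschitzOnWith K (fderiv ℝ P) s) (hs₀ : 0 ∈ s) (hP₀ : P 0 = 0)
    (hP'₀ : fderiv ℝ P 0 = 0) {I : Set ℝ} {t : ℝ} (ht : t ∈ I) {Z : ℝ → Lp E 2 μ}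
    {Z' : Lp E 2 μ} (hZ : HasDerivWithinAt Z Z' I t)
    (hZs : ∀ᶠ τ in 𝓝[I] t, ∀ᵐ x ∂μ, Z τ x ∈ s) :
    HasDerivWithinAt (fun τ => ∫ x, P (Z τ x) ∂μ) (∫ x, fderiv ℝ P (Z t x) (Z' x) ∂μ) I t := by
  have hcomp := ((hasFDerivWithinAt_integral_comp hP hs hK hs₀ hP₀ hP'₀
    (hZs.self_of_nhdsWithin ht)).comp_of_tendsto t hZ.hasFDerivWithinAt
      (tendsto_nhdsWithin_iff.2 ⟨hZ.continuousWithinAt, hZs⟩)).hasDerivWithinAt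
  simpa [integralApplyCLM_apply, Function.comp_def] using hcomp

end IntegralFunctional

section EulerLagrange

variable {L : ℝ × ℝ → ℝ}

/-- The Euler–Lagrange expression `L_u - ∂ₓ (L_p)` of the functional `u ↦ ∫ L(u, u_x)`, as a
function of the jet `z = (u, p)` with `p = u_x`, and of `q = u_xx`. -/
def eulerLagrange (L : ℝ × ℝ → ℝ) (z : ℝ × ℝ) (q : ℝ) : ℝ :=
  fderiv ℝ L z (1, 0) - fderiv ℝ (fun y => fderiv ℝ L y (0, 1)) z (z.2, q)

theorem clm_apply_eq_mul_add_mul (A : ℝ × ℝ →L[ℝ] ℝ) (z : ℝ × ℝ) :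
    A z = A (1, 0) * z.1 + A (0, 1) * z.2 := by
  conv_lhs => rw [show z = z.1 • (1, 0) + z.2 • (0, 1) by simp, map_add, map_smul, map_smul]
  simp only [smul_eq_mul, mul_comm]

theorem contDiff_fderiv_apply (hL : ContDiff ℝ 2 L) (w : ℝ × ℝ) :
    ContDiff ℝ 1 fun z => fderiv ℝ L z w :=
  (hL.fderiv_right (m := 1) (by norm_num)).clm_apply contDiff_const

theorem continuous_eulerLagrange (hL : ContDiff ℝ 2 L) :
    Continuous fun y : (ℝ × ℝ) × ℝ => eulerLagrange L y.1 y.2 := by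
  have h₁ := (contDiff_fderiv_apply hL (1, 0)).continuous
  have h₂ := (contDiff_fderiv_apply hL (0, 1)).continuous_fderiv one_ne_zero
  exact (h₁.comp continuous_fst).sub
    ((h₂.comp continuous_fst).clm_apply (continuous_fst.snd.prodMk continuous_snd))

/-- The Beltrami identity: the right-hand side is the total derivative `∂ₓ (L - p L_p)`. -/
theorem snd_mul_eulerLagrange (hL : ContDiff ℝ 2 L) (z : ℝ × ℝ) (q : ℝ) :
    z.2 * eulerLagrange L z q =
      fderiv ℝ (fun y => L y - y.2 * fderiv ℝ L y (0, 1)) z (z.2, q) := by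
  have hLz := (hL.differentiable two_ne_zero z).hasFDerivAt
  have hLp := ((contDiff_fderiv_apply hL (0, 1)).differentiable one_ne_zero z).hasFDerivAt
  have hsnd : HasFDerivAt (fun y : ℝ × ℝ => y.2) (ContinuousLinearMap.snd ℝ ℝ ℝ) z :=
    hasFDerivAt_snd
  rw [(hLz.fun_sub (hsnd.fun_mul hLp)).fderiv, eulerLagrange]
  simp only [_root_.sub_apply, _root_.add_apply, _root_.smul_apply, smul_eq_mul,
    ContinuousLinearMap.coe_snd', clm_apply_eq_mul_add_mul (fderiv ℝ L z) (z.2, q)]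
  ring

end EulerLagrange

section DensityPoly

/-- The density of `H₂` as a polynomial in `(u, u_x)`; the term `k = 0` is `u^(2n+1)`. -/
def densityPoly (n : ℕ) (z : ℝ × ℝ) : ℝ :=
  ∑ k ∈ Finset.range (n + 1), (-1 : ℝ) ^ (k + 1) / (2 * (k : ℝ) - 1) * (n.choose k : ℝ)
    * z.1 ^ (2 * n - 2 * k + 1) * z.2 ^ (2 * k)

theorem contDiff_densityPoly (n : ℕ) : ContDiff ℝ 2 (densityPoly n) := by
  unfold densityPoly
  fun_prop

theorem densityPoly_zero (n : ℕ) : densityPoly n 0 = 0 := by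
  simp [densityPoly]

theorem fderiv_densityPoly_apply (n : ℕ) (z w : ℝ × ℝ) :
    fderiv ℝ (densityPoly n) z w =
      ∑ k ∈ Finset.range (n + 1), (-1 : ℝ) ^ (k + 1) / (2 * (k : ℝ) - 1) * (n.choose k : ℝ)
        * ((2 * n - 2 * k + 1 : ℕ) * z.1 ^ (2 * n - 2 * k) * z.2 ^ (2 * k) * w.1
          + z.1 ^ (2 * n - 2 * k + 1) * ((2 * k : ℕ) * z.2 ^ (2 * k - 1)) * w.2) := by
  have hfst : HasFDerivAt (fun y : ℝ × ℝ => y.1) (ContinuousLinearMap.fst ℝ ℝ ℝ) z :=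
    hasFDerivAt_fst
  have hsnd : HasFDerivAt (fun y : ℝ × ℝ => y.2) (ContinuousLinearMap.snd ℝ ℝ ℝ) z :=
    hasFDerivAt_snd
  have hsum := HasFDerivAt.fun_sum (u := Finset.range (n + 1)) fun k _ =>
    ((hfst.pow (2 * n - 2 * k + 1)).const_mul
      ((-1 : ℝ) ^ (k + 1) / (2 * (k : ℝ) - 1) * (n.choose k : ℝ))).mul (hsnd.pow (2 * k))
  rw [HasFDerivAt.fderiv (f := densityPoly n) hsum]
  simp only [_root_.sum_apply, _root_.add_apply, _root_.smul_apply, ContinuousLinearMap.coe_fst',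
    ContinuousLinearMap.coe_snd', smul_eq_mul, Nat.add_sub_cancel, nsmul_eq_mul]
  exact Finset.sum_congr rfl fun k _ => by ring

theorem fderiv_densityPoly_zero {n : ℕ} (hn : n ≠ 0) : fderiv ℝ (densityPoly n) 0 = 0 := by
  refine ContinuousLinearMap.ext fun w => ?_
  rw [fderiv_densityPoly_apply, _root_.zero_apply]
  refine Finset.sum_eq_zero fun k _ => ?_
  have hzero : (0 : ℝ) ^ (2 * n - 2 * k) * 0 ^ (2 * k) = 0 := by
    rw [← pow_add]
    exact zero_pow (by omega)
  simp only [Prod.fst_zero, Prod.snd_zero, mul_assoc _ ((0 : ℝ) ^ (2 * n - 2 * k)), hzero,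
    pow_succ, mul_zero, zero_mul, add_zero]

theorem densityPoly_sub_snd_mul_fderiv (n : ℕ) (z : ℝ × ℝ) :
    densityPoly n z - z.2 * fderiv ℝ (densityPoly n) z (0, 1) =
      z.1 * (z.1 ^ 2 - z.2 ^ 2) ^ n := by
  rw [sub_eq_neg_add (z.1 ^ 2), add_pow, fderiv_densityPoly_apply, densityPoly, Finset.mul_sum,
    Finset.mul_sum, ← Finset.sum_sub_distrib]
  refine Finset.sum_congr rfl fun k _ => ?_
  have hcoeff : (-1 : ℝ) ^ (k + 1) / (2 * (k : ℝ) - 1) * (1 - 2 * k) = (-1) ^ k := by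
    have hodd : (2 * (k : ℝ) - 1) ≠ 0 := fun h => by
      have : 2 * k = 1 := by exact_mod_cast sub_eq_zero.1 h
      omega
    field_simp
    ring
  have hpow : z.2 * ((2 * k : ℕ) * z.2 ^ (2 * k - 1)) = 2 * k * z.2 ^ (2 * k) := by
    rcases k with _ | k
    · simp
    · rw [show 2 * (k + 1) - 1 = 2 * k + 1 by omega]; push_cast; ring
  have hexp : z.1 * (z.1 ^ 2) ^ (n - k) = z.1 ^ (2 * n - 2 * k + 1) := by
    rw [← pow_mul, Nat.mul_sub, pow_succ']
  rw [neg_pow (z.2 ^ 2), ← pow_mul z.2]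
  linear_combination ((n.choose k : ℝ) * z.1 ^ (2 * n - 2 * k + 1)) *
      (z.2 ^ (2 * k) * hcoeff - (-1 : ℝ) ^ (k + 1) / (2 * (k : ℝ) - 1) * hpow) -
    ((-1) ^ k * z.2 ^ (2 * k) * (n.choose k : ℝ)) * hexp

/-- The Beltrami identity gives the formula where `u_x ≠ 0`, and continuity gives it everywhere. -/
theorem eulerLagrange_densityPoly (n : ℕ) (z : ℝ × ℝ) (q : ℝ) :
    eulerLagrange (densityPoly n) z q =
      (z.1 ^ 2 - z.2 ^ 2) ^ n + 2 * n * ((z.1 ^ 2 - z.2 ^ 2) ^ (n - 1) * z.1 * (z.1 - q)) := by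
  obtain ⟨a, b⟩ := z
  have hcont : Continuous fun b : ℝ => eulerLagrange (densityPoly n) (a, b) q :=
    (continuous_eulerLagrange (contDiff_densityPoly n)).comp
      (by fun_prop : Continuous fun b : ℝ => ((a, b), q))
  refine congrFun (hcont.ext_on (dense_compl_singleton 0) (g := fun b : ℝ =>
    (a ^ 2 - b ^ 2) ^ n + 2 * n * ((a ^ 2 - b ^ 2) ^ (n - 1) * a * (a - q))) (by fun_prop)
    fun b hb => mul_left_cancel₀ hb ?_) b
  have hfst : HasFDerivAt (fun y : ℝ × ℝ => y.1) (ContinuousLinearMap.fst ℝ ℝ ℝ) (a, b) :=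
    hasFDerivAt_fst
  have hsnd : HasFDerivAt (fun y : ℝ × ℝ => y.2) (ContinuousLinearMap.snd ℝ ℝ ℝ) (a, b) :=
    hasFDerivAt_snd
  rw [snd_mul_eulerLagrange (contDiff_densityPoly n) (a, b) q]
  simp only [densityPoly_sub_snd_mul_fderiv]
  rw [(hfst.fun_mul (((hfst.pow 2).fun_sub (hsnd.pow 2)).pow n)).fderiv]
  simp only [nsmul_eq_mul, Nat.add_one_sub_one, pow_one, Nat.cast_ofNat, _root_.add_apply,
    _root_.smul_apply, _root_.sub_apply, ContinuousLinearMap.coe_fst', smul_eq_mul,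
    ContinuousLinearMap.coe_snd']
  ring

end DensityPoly

section Jet

variable {f : ℝ → ℝ} {L : ℝ × ℝ → ℝ}

/-- The first-order jet `(f, f_x)`. -/
def jet (f : ℝ → ℝ) (x : ℝ) : ℝ × ℝ := (f x, deriv f x)

theorem H2density_eq_densityPoly (n : ℕ) (f : ℝ → ℝ) (x : ℝ) :
    H2density n f x = densityPoly n (jet f x) := by
  have hrange : Finset.range (n + 1) = insert 0 (Finset.Icc 1 n) := by
    ext k
    simp only [Finset.mem_range, Finset.mem_insert, Finset.mem_Icc]
    omega
  rw [densityPoly, hrange, Finset.sum_insert (by simp)]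
  simp [H2density, jet]

theorem continuous_jet (hf : ContDiff ℝ 1 f) : Continuous (jet f) :=
  hf.continuous.prodMk (hf.continuous_deriv le_rfl)

theorem hasDerivAt_deriv_of_contDiff (hf : ContDiff ℝ 2 f) (x : ℝ) :
    HasDerivAt (deriv f) (deriv (deriv f) x) x :=
  ((ContDiff.deriv' hf : ContDiff ℝ 1 (deriv f)).differentiable one_ne_zero x).hasDerivAt

theorem continuous_deriv_deriv (hf : ContDiff ℝ 2 f) : Continuous (deriv (deriv f)) :=
  (ContDiff.deriv' hf : ContDiff ℝ 1 (deriv f)).continuous_deriv le_rfl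

theorem hasDerivAt_jet (hf : ContDiff ℝ 2 f) (x : ℝ) :
    HasDerivAt (jet f) (deriv f x, deriv (deriv f) x) x :=
  (hf.differentiable two_ne_zero x).hasDerivAt.prodMk (hasDerivAt_deriv_of_contDiff hf x)

theorem continuous_eulerLagrange_jet (hf : ContDiff ℝ 2 f) (hL : ContDiff ℝ 2 L) :
    Continuous fun x => eulerLagrange L (jet f x) (deriv (deriv f) x) :=
  (continuous_eulerLagrange hL).comp
    ((continuous_jet (hf.of_le one_le_two)).prodMk (continuous_deriv_deriv hf))

theorem hasDerivAt_fderiv_jet (hf : ContDiff ℝ 2 f) (hL : ContDiff ℝ 2 L) (x : ℝ) :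
    HasDerivAt (fun x => fderiv ℝ L (jet f x) (0, 1))
      (fderiv ℝ L (jet f x) (1, 0) - eulerLagrange L (jet f x) (deriv (deriv f) x)) x := by
  rw [eulerLagrange, sub_sub_cancel]
  exact ((contDiff_fderiv_apply hL (0, 1)).differentiable one_ne_zero _).hasFDerivAt.comp_hasDerivAt
    x (hasDerivAt_jet hf x)

theorem integral_momentum_mul (hf : ContDiff ℝ 2 f) {φ : ℝ → ℝ} (hφ : ContDiff ℝ ∞ φ)
    (hφc : HasCompactSupport φ) :
    ∫ x, momentum f x * φ x = ∫ x, (φ x * f x + deriv φ x * deriv f x) := by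
  have hφ' : Continuous (deriv φ) := hφ.continuous_deriv (by simp)
  have h₀ := integrable_testFunction_smul hφ.continuous hφc hf.continuous
  have h₁ := integrable_testFunction_smul hφ' hφc.deriv (hf.continuous_deriv one_le_two)
  have h₂ := integrable_testFunction_smul hφ.continuous hφc (continuous_deriv_deriv hf)
  have hparts := HasWeakDeriv.of_hasDerivAt (hasDerivAt_deriv_of_contDiff hf)
    (continuous_deriv_deriv hf) φ hφ hφc
  simp only [smul_eq_mul] at h₀ h₁ h₂ hparts
  rw [integral_add h₀ h₁, hparts, ← sub_eq_add_neg, ← integral_sub h₀ h₂]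
  simp only [momentum, sub_mul, mul_comm (φ _)]

theorem hasDerivAt_sq_sub_sq_pow (hf : ContDiff ℝ 2 f) (n : ℕ) (x : ℝ) :
    HasDerivAt (fun x => (f x ^ 2 - deriv f x ^ 2) ^ n)
      (2 * n * ((f x ^ 2 - deriv f x ^ 2) ^ (n - 1) * deriv f x * momentum f x)) x := by
  refine ((((hf.differentiable two_ne_zero x).hasDerivAt.pow 2).sub
    ((hasDerivAt_deriv_of_contDiff hf x).pow 2)).pow n).congr_deriv ?_
  simp only [momentum, Pi.sub_apply, Pi.pow_apply, Nat.add_one_sub_one, pow_one, Nat.cast_ofNat]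
  ring

/-- The equation has the form `m_t = -(2n)⁻¹ ∂ₓ (δH₂/δu)`, since
`2n (u² - u_x²)^(n-1) u_x m = ∂ₓ (u² - u_x²)^n`. -/
theorem flux_eq_integral_eulerLagrange (hf : ContDiff ℝ 2 f) {n : ℕ} (hn : n ≠ 0) {φ : ℝ → ℝ}
    (hφ : ContDiff ℝ ∞ φ) (hφc : HasCompactSupport φ) :
    -(∫ x, (f x ^ 2 - deriv f x ^ 2) ^ (n - 1) * deriv f x * momentum f x * φ x) +
        ∫ x, (f x ^ 2 - deriv f x ^ 2) ^ (n - 1) * f x * momentum f x * deriv φ x =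
      ∫ x, deriv φ x *
        ((2 * n : ℝ)⁻¹ * eulerLagrange (densityPoly n) (jet f x) (deriv (deriv f) x)) := by
  have hφ' : Continuous (deriv φ) := hφ.continuous_deriv (by simp)
  have hfc := hf.continuous
  have hf' := hf.continuous_deriv one_le_two
  have hm : Continuous (momentum f) := hfc.sub (continuous_deriv_deriv hf)
  have hn₀ : (2 * n : ℝ) ≠ 0 := by positivity
  have hpow := integrable_testFunction_smul hφ' hφc.deriv
    (by fun_prop : Continuous fun x => (f x ^ 2 - deriv f x ^ 2) ^ n)
  have hflux := integrable_testFunction_smul hφ' hφc.deriv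
    (by fun_prop : Continuous fun x => (f x ^ 2 - deriv f x ^ 2) ^ (n - 1) * f x * momentum f x)
  have hparts := HasWeakDeriv.of_hasDerivAt (hasDerivAt_sq_sub_sq_pow hf n) (by fun_prop) φ hφ hφc
  simp only [smul_eq_mul, mul_left_comm (φ _) (2 * n : ℝ), integral_const_mul] at hpow hflux hparts
  calc -(∫ x, (f x ^ 2 - deriv f x ^ 2) ^ (n - 1) * deriv f x * momentum f x * φ x) +
        ∫ x, (f x ^ 2 - deriv f x ^ 2) ^ (n - 1) * f x * momentum f x * deriv φ x
      = (2 * n : ℝ)⁻¹ * (∫ x, deriv φ x * (f x ^ 2 - deriv f x ^ 2) ^ n) +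
          ∫ x, deriv φ x * ((f x ^ 2 - deriv f x ^ 2) ^ (n - 1) * f x * momentum f x) := by
        rw [hparts, mul_neg, inv_mul_cancel_left₀ hn₀]
        simp only [mul_comm _ (φ _), mul_comm _ (deriv φ _)]
    _ = _ := by
        rw [← integral_const_mul, ← integral_add (hpow.const_mul _) hflux]
        refine integral_congr_ae (.of_forall fun x => ?_)
        simp only [eulerLagrange_densityPoly, jet, momentum]
        field_simp

end Jet

section IsRegular

variable {f : ℝ → ℝ} {L : ℝ × ℝ → ℝ}

/-- The spatial regularity of solutions at a fixed time: `f` is `C²`, `f`, `f_x` and `f_xx` belong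
to `L²`, and `f` and `f_x` are bounded. It holds for the functions of class `H^s`, `s > 5/2`. -/
structure IsRegular (f : ℝ → ℝ) : Prop where
  contDiff : ContDiff ℝ 2 f
  memLp_jet : MemLp (jet f) 2
  memLp_deriv_deriv : MemLp (deriv (deriv f)) 2
  exists_norm_jet_le : ∃ R, ∀ x, ‖jet f x‖ ≤ R

namespace IsRegular

theorem memLp_top_comp_jet {F : Type*} [NormedAddCommGroup F] (hf : IsRegular f)
    {g : ℝ × ℝ → F} (hg : Continuous g) : MemLp (fun x => g (jet f x)) ⊤ := by
  obtain ⟨R, hR⟩ := hf.exists_norm_jet_le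
  obtain ⟨C, hC⟩ :=
    (isCompact_closedBall (0 : ℝ × ℝ) R).exists_bound_of_continuousOn hg.continuousOn
  exact memLp_top_of_bound
    (hg.comp (continuous_jet (hf.contDiff.of_le one_le_two))).aestronglyMeasurable C
    (Eventually.of_forall fun x => hC _ (mem_closedBall_zero_iff.2 (hR x)))

theorem memLp_fderiv_comp_jet (hf : IsRegular f) (hL : ContDiff ℝ 2 L) (hL' : fderiv ℝ L 0 = 0) :
    MemLp (fun x => fderiv ℝ L (jet f x)) 2 := by
  obtain ⟨R, hR⟩ := hf.exists_norm_jet_le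
  obtain ⟨K, hK⟩ := exists_lipschitzOnWith_fderiv_closedBall hL R
  exact memLp_fderiv_comp (hL.of_le one_le_two) hK
    (Metric.mem_closedBall_self ((norm_nonneg _).trans (hR 0))) hL' hf.memLp_jet
    (Eventually.of_forall fun x => mem_closedBall_zero_iff.2 (hR x))

theorem memLp_fderiv_comp_jet_apply (hf : IsRegular f) (hL : ContDiff ℝ 2 L)
    (hL' : fderiv ℝ L 0 = 0) (w : ℝ × ℝ) : MemLp (fun x => fderiv ℝ L (jet f x) w) 2 :=
  (ContinuousLinearMap.apply ℝ ℝ w).comp_memLp' (hf.memLp_fderiv_comp_jet hL hL')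

theorem integrable_comp_jet (hf : IsRegular f) (hL : ContDiff ℝ 2 L) (hL₀ : L 0 = 0)
    (hL' : fderiv ℝ L 0 = 0) : Integrable fun x => L (jet f x) := by
  obtain ⟨R, hR⟩ := hf.exists_norm_jet_le
  obtain ⟨K, hK⟩ := exists_lipschitzOnWith_fderiv_closedBall hL R
  exact integrable_comp_of_fderiv_zero (hL.differentiable two_ne_zero)
    (convex_closedBall 0 R) hK (Metric.mem_closedBall_self ((norm_nonneg _).trans (hR 0))) hL₀ hL'
    hf.memLp_jet (Eventually.of_forall fun x => mem_closedBall_zero_iff.2 (hR x))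

theorem memLp_eulerLagrange (hf : IsRegular f) (hL : ContDiff ℝ 2 L) (hL' : fderiv ℝ L 0 = 0) :
    MemLp (fun x => eulerLagrange L (jet f x) (deriv (deriv f) x)) 2 := by
  have hLp := hf.memLp_top_comp_jet
    ((contDiff_fderiv_apply hL (0, 1)).continuous_fderiv one_ne_zero)
  exact (hf.memLp_fderiv_comp_jet_apply hL hL' (1, 0)).sub
    ((ContinuousLinearMap.id ℝ (ℝ × ℝ →L[ℝ] ℝ)).memLp_of_bilin (p := ⊤) (q := 2) 2 hLp
      (.of_fst_snd ⟨hf.memLp_jet.snd, hf.memLp_deriv_deriv⟩))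

theorem integral_fderiv_jet (hf : IsRegular f) (hL : ContDiff ℝ 2 L) (hL' : fderiv ℝ L 0 = 0)
    {v : ℝ → ℝ} (hv : Differentiable ℝ v) (hv₂ : MemLp (jet v) 2) :
    ∫ x, fderiv ℝ L (jet f x) (jet v x) =
      ∫ x, eulerLagrange L (jet f x) (deriv (deriv f) x) * v x := by
  have hLu := hf.memLp_fderiv_comp_jet_apply hL hL' (1, 0)
  have hLp := hf.memLp_fderiv_comp_jet_apply hL hL' (0, 1)
  have hE := hf.memLp_eulerLagrange hL hL'
  have hLuv : Integrable fun x => fderiv ℝ L (jet f x) (1, 0) * v x := hLu.integrable_mul hv₂.fst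
  have hLpv : Integrable fun x => fderiv ℝ L (jet f x) (0, 1) * deriv v x :=
    hLp.integrable_mul hv₂.snd
  have hEv : Integrable fun x => eulerLagrange L (jet f x) (deriv (deriv f) x) * v x :=
    hE.integrable_mul hv₂.fst
  have hparts := integral_mul_deriv_eq_deriv_mul_of_integrable
    (fun x _ => hasDerivAt_fderiv_jet hf.contDiff hL x) (fun x _ => (hv x).hasDerivAt)
    hLpv ((hLu.sub hE).integrable_mul hv₂.fst)
    (hLp.integrable_mul hv₂.fst)
  simp only [sub_mul] at hparts
  calc ∫ x, fderiv ℝ L (jet f x) (jet v x)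
      = ∫ x, (fderiv ℝ L (jet f x) (1, 0) * v x + fderiv ℝ L (jet f x) (0, 1) * deriv v x) :=
        integral_congr_ae (.of_forall fun x => clm_apply_eq_mul_add_mul _ (jet v x))
    _ = ∫ x, eulerLagrange L (jet f x) (deriv (deriv f) x) * v x := by
        rw [integral_add hLuv hLpv, hparts, integral_sub hLuv hEv]
        ring

end IsRegular

end IsRegular

section SobolevCurve

/-- The map `(f, g) ↦ (x ↦ (f x, g x))` from pairs of `Lᵖ` functions to `Lᵖ` functions
with values in pairs. -/
def prodMkLpL {α E F : Type*} [MeasurableSpace α] (p : ENNReal) [Fact (1 ≤ p)] (μ : Measure α)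
    [NormedAddCommGroup E] [NormedSpace ℝ E] [NormedAddCommGroup F] [NormedSpace ℝ F] :
    Lp E p μ × Lp F p μ →L[ℝ] Lp (E × F) p μ :=
  ((ContinuousLinearMap.inl ℝ E F).compLpL p μ).coprod ((ContinuousLinearMap.inr ℝ E F).compLpL p μ)

theorem coeFn_prodMkLpL {α E F : Type*} [MeasurableSpace α] {p : ENNReal} [Fact (1 ≤ p)]
    {μ : Measure α} [NormedAddCommGroup E] [NormedSpace ℝ E] [NormedAddCommGroup F]
    [NormedSpace ℝ F] (f : Lp E p μ) (g : Lp F p μ) :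
    prodMkLpL p μ (f, g) =ᵐ[μ] fun x => (f x, g x) := by
  filter_upwards [Lp.coeFn_add ((ContinuousLinearMap.inl ℝ E F).compLpL p μ f)
      ((ContinuousLinearMap.inr ℝ E F).compLpL p μ g),
    (ContinuousLinearMap.inl ℝ E F).coeFn_compLpL f,
    (ContinuousLinearMap.inr ℝ E F).coeFn_compLpL g] with x hadd hf hg
  rw [prodMkLpL, ContinuousLinearMap.coprod_apply, hadd, Pi.add_apply, hf, hg]
  simp

variable {σ : ℝ}

/-- The operator sending `G` to the jet of the real part of `⟨D⟩^(-σ) G`. -/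
def sobolevJetL2 (σ : ℝ) (h : 1 ≤ σ) :
    Lp ℂ 2 (volume : Measure ℝ) →L[ℝ] Lp (ℝ × ℝ) 2 (volume : Measure ℝ) :=
  prodMkLpL 2 volume ∘L (sobolevL2 σ 0 (by rw [Nat.cast_zero]; linarith)).prod
    (sobolevL2 σ 1 (by rwa [Nat.cast_one]))

theorem coeFn_sobolevJetL2 (h : 1 ≤ σ) (h' : 3 / 2 < σ) (G : Lp ℂ 2 (volume : Measure ℝ)) :
    sobolevJetL2 σ h G =ᵐ[volume] jet (sobolevRep σ 0 G) := by
  filter_upwards [coeFn_prodMkLpL (sobolevL2 σ 0 (by rw [Nat.cast_zero]; linarith) G)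
      (sobolevL2 σ 1 (by rwa [Nat.cast_one]) G),
    coeFn_sobolevL2 (σ := σ) (j := 0) (by rw [Nat.cast_zero]; linarith)
      (by rw [Nat.cast_zero]; linarith) G,
    coeFn_sobolevL2 (σ := σ) (j := 1) (by rwa [Nat.cast_one])
      (by rw [Nat.cast_one]; linarith) G] with x hpair h₀ h₁
  refine hpair.trans ?_
  rw [h₀, h₁, jet, deriv_sobolevRep (by rw [Nat.cast_zero]; linarith)]

theorem memLp_jet_sobolevRep (h : 3 / 2 < σ) (G : Lp ℂ 2 (volume : Measure ℝ)) :
    MemLp (jet (sobolevRep σ 0 G)) 2 :=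
  (memLp_congr_ae (coeFn_sobolevJetL2 (by linarith) h G)).1 (Lp.memLp _)

theorem exists_norm_jet_sobolevRep_le (h : 3 / 2 < σ) :
    ∃ C : ℝ, ∀ (G : Lp ℂ 2 (volume : Measure ℝ)) (x : ℝ),
      ‖jet (sobolevRep σ 0 G) x‖ ≤ C * ‖G‖ := by
  obtain ⟨C₀, hC₀⟩ := exists_norm_sobolevRep_le (σ := σ) (j := 0) (by rw [Nat.cast_zero]; linarith)
  obtain ⟨C₁, hC₁⟩ := exists_norm_sobolevRep_le (σ := σ) (j := 1) (by rw [Nat.cast_one]; linarith)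
  refine ⟨max C₀ C₁, fun G x => ?_⟩
  rw [jet, deriv_sobolevRep (by rw [Nat.cast_zero]; linarith),
    max_mul_of_nonneg _ _ (norm_nonneg G)]
  exact max_le_max (hC₀ G x) (hC₁ G x)

theorem isRegular_sobolevRep (h : 5 / 2 < σ) (G : Lp ℂ 2 (volume : Measure ℝ)) :
    IsRegular (sobolevRep σ 0 G) where
  contDiff := contDiff_sobolevRep (k := 2) (by norm_num; linarith) G
  memLp_jet := memLp_jet_sobolevRep (by linarith) G
  memLp_deriv_deriv := by
    rw [deriv_sobolevRep (by norm_num; linarith), deriv_sobolevRep (by norm_num; linarith)]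
    exact memLp_sobolevRep (by norm_num; linarith) G
  exists_norm_jet_le :=
    let ⟨C, hC⟩ := exists_norm_jet_sobolevRep_le (σ := σ) (by linarith)
    ⟨C * ‖G‖, hC G⟩

variable {u : ℝ → ℝ → ℝ} {v : ℝ → ℝ} {I : Set ℝ} {t : ℝ} {L : ℝ × ℝ → ℝ}

/-- The curve `τ ↦ u τ` has derivative `v` at `t` within `I` as a curve in `H¹(ℝ)`, the norm of
which is the `L²` norm of the jet. -/
def HasH1DerivWithinAt (u : ℝ → ℝ → ℝ) (v : ℝ → ℝ) (I : Set ℝ) (t : ℝ) : Prop :=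
  ∃ (Z : ℝ → Lp (ℝ × ℝ) 2 (volume : Measure ℝ)) (Z' : Lp (ℝ × ℝ) 2 (volume : Measure ℝ)),
    (∀ τ ∈ I, Z τ =ᵐ[volume] jet (u τ)) ∧ Z' =ᵐ[volume] jet v ∧ HasDerivWithinAt Z Z' I t

theorem HasH1DerivWithinAt.integral_apply (h : HasH1DerivWithinAt u v I t) (ht : t ∈ I)
    {g : ℝ → ℝ × ℝ →L[ℝ] ℝ} (hg : MemLp g 2) :
    HasDerivWithinAt (fun τ => ∫ x, g x (jet (u τ) x)) (∫ x, g x (jet v x)) I t := by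
  obtain ⟨Z, Z', hZ, hZ', hder⟩ := h
  have heq {Y : Lp (ℝ × ℝ) 2 (volume : Measure ℝ)} {z : ℝ → ℝ × ℝ} (hY : Y =ᵐ[volume] z) :
      ∫ x, g x (z x) = integralApplyCLM hg Y := by
    rw [integralApplyCLM_apply]
    exact integral_congr_ae (hY.mono fun x hx => congrArg (g x) hx.symm)
  rw [heq hZ']
  exact ((integralApplyCLM hg).hasFDerivAt.comp_hasDerivWithinAt t hder).congr
    (fun τ hτ => heq (hZ τ hτ)) (heq (hZ t ht))

theorem HasH1DerivWithinAt.integral_comp (h : HasH1DerivWithinAt u v I t) (ht : t ∈ I)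
    (hL : ContDiff ℝ 2 L) (hL₀ : L 0 = 0) (hL' : fderiv ℝ L 0 = 0) {R : ℝ}
    (hR : ∀ᶠ τ in 𝓝[I] t, ∀ x, ‖jet (u τ) x‖ ≤ R) :
    HasDerivWithinAt (fun τ => ∫ x, L (jet (u τ) x)) (∫ x, fderiv ℝ L (jet (u t) x) (jet v x))
      I t := by
  obtain ⟨Z, Z', hZ, hZ', hder⟩ := h
  obtain ⟨K, hK⟩ := exists_lipschitzOnWith_fderiv_closedBall hL R
  have hR₀ : 0 ≤ R := (norm_nonneg _).trans (hR.self_of_nhdsWithin ht 0)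
  have hZR : ∀ᶠ τ in 𝓝[I] t, ∀ᵐ x, Z τ x ∈ Metric.closedBall 0 R := by
    filter_upwards [hR, self_mem_nhdsWithin] with τ hτ hτI
    filter_upwards [hZ τ hτI] with x hx
    exact hx ▸ mem_closedBall_zero_iff.2 (hτ x)
  have hcomp := hasDerivWithinAt_integral_comp (hL.of_le one_le_two) (convex_closedBall 0 R) hK
    (Metric.mem_closedBall_self hR₀) hL₀ hL' ht hder hZR
  have hval {τ : ℝ} (hτ : τ ∈ I) : ∫ x, L (jet (u τ) x) = ∫ x, L (Z τ x) :=
    integral_congr_ae ((hZ τ hτ).mono fun x hx => congrArg L hx.symm)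
  refine (hcomp.congr (fun τ => hval) (hval ht)).congr_deriv (integral_congr_ae ?_)
  filter_upwards [hZ t ht, hZ'] with x hx hx'
  rw [hx, hx']

theorem HasH1DerivWithinAt.integral_momentum_mul (h : HasH1DerivWithinAt u v I t) (ht : t ∈ I)
    (hu : ∀ τ ∈ I, ContDiff ℝ 2 (u τ)) {φ : ℝ → ℝ} (hφ : ContDiff ℝ ∞ φ)
    (hφc : HasCompactSupport φ) :
    HasDerivWithinAt (fun τ => ∫ x, momentum (u τ) x * φ x)
      (∫ x, (φ x * v x + deriv φ x * deriv v x)) I t := by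
  have hφ' : Continuous (deriv φ) := hφ.continuous_deriv (by simp)
  have hφ₀ := hφ.continuous
  have hg : MemLp (fun x => φ x • ContinuousLinearMap.fst ℝ ℝ ℝ +
      deriv φ x • ContinuousLinearMap.snd ℝ ℝ ℝ) 2 :=
    (by fun_prop : Continuous _).memLp_of_hasCompactSupport
      (hφc.smul_right.add hφc.deriv.smul_right)
  exact (h.integral_apply ht hg).congr (fun τ hτ => HOCH.integral_momentum_mul (hu τ hτ) hφ hφc)
    (HOCH.integral_momentum_mul (hu t ht) hφ hφc)

theorem IsSobolevCurve.exists_eq_sobolevRep {k : ℕ} (hu : IsSobolevCurve k σ I u) (hσ : 1 / 2 < σ)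
    (huc : ∀ t ∈ I, Continuous (u t)) :
    ∃ F : ℝ → Lp ℂ 2 (volume : Measure ℝ), ContDiffOn ℝ k F I ∧
      ∀ t ∈ I, u t = sobolevRep σ 0 (F t) :=
  let ⟨F, hF, hFu⟩ := hu
  ⟨F, hF, fun t ht =>
    let ⟨h, hb⟩ := hFu t ht
    eq_sobolevRep_of_besselPotential_eq hσ (huc t ht) h hb⟩

theorem IsSobolevCurve.exists_eventually_norm_jet_le {k : ℕ} (hu : IsSobolevCurve k σ I u)
    (hσ : 3 / 2 < σ) (huc : ∀ t ∈ I, Continuous (u t)) (ht : t ∈ I) :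
    ∃ R, ∀ᶠ τ in 𝓝[I] t, ∀ x, ‖jet (u τ) x‖ ≤ R := by
  obtain ⟨F, hF, hFu⟩ := hu.exists_eq_sobolevRep (by linarith) huc
  obtain ⟨C, hC⟩ := exists_norm_jet_sobolevRep_le hσ
  have hlim : Tendsto (fun τ => C * ‖F τ‖) (𝓝[I] t) (𝓝 (C * ‖F t‖)) :=
    (hF.continuousOn t ht).norm.const_mul C
  refine ⟨C * ‖F t‖ + 1, ?_⟩
  filter_upwards [hlim.eventually_le_const (lt_add_one _), self_mem_nhdsWithin] with τ hτ hτI x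
  exact hFu τ hτI ▸ (hC (F τ) x).trans hτ

theorem IsSobolevCurve.exists_hasH1DerivWithinAt (hu : IsSobolevCurve 1 σ I u) (hσ : 3 / 2 < σ)
    (huc : ∀ t ∈ I, Continuous (u t)) (ht : t ∈ I) :
    ∃ v, ContDiff ℝ 1 v ∧ MemLp (jet v) 2 ∧ HasH1DerivWithinAt u v I t := by
  obtain ⟨F, hF, hFu⟩ := hu.exists_eq_sobolevRep (by linarith) huc
  have hF' := (hF.differentiableOn one_ne_zero t ht).hasDerivWithinAt
  have hσ₁ : 1 ≤ σ := by linarith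
  refine ⟨sobolevRep σ 0 (derivWithin F I t),
    contDiff_sobolevRep (k := 1) (by norm_num; linarith) _, memLp_jet_sobolevRep hσ _,
    fun τ => sobolevJetL2 σ hσ₁ (F τ), _, fun τ hτ => ?_, coeFn_sobolevJetL2 hσ₁ hσ _,
    (sobolevJetL2 σ hσ₁).hasFDerivAt.comp_hasDerivWithinAt t hF'⟩
  rw [hFu τ hτ]
  exact coeFn_sobolevJetL2 hσ₁ hσ (F τ)

end SobolevCurve

section StrongSolution

variable {n : ℕ} {s : ℝ} {T : EReal} {u : ℝ → ℝ → ℝ} {t : ℝ}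

theorem convex_timeInterval (T : EReal) : Convex ℝ (timeInterval T) :=
  Set.OrdConnected.convex ⟨fun _ hx _ hy _ hz =>
    ⟨hx.1.trans hz.1, (EReal.coe_le_coe_iff.2 hz.2).trans_lt hy.2⟩⟩

theorem zero_mem_timeInterval (hT : 0 < T) : 0 ∈ timeInterval T :=
  ⟨le_rfl, by simpa using hT⟩

theorem uniqueDiffOn_timeInterval (hT : 0 < T) : UniqueDiffOn ℝ (timeInterval T) := by
  obtain ⟨r, hr, hrT⟩ := EReal.lt_iff_exists_real_btwn.1 hT
  have hsub : Set.Ioo 0 r ⊆ timeInterval T :=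
    fun x hx => ⟨hx.1.le, (EReal.coe_lt_coe_iff.2 hx.2).trans hrT⟩
  refine uniqueDiffOn_convex (convex_timeInterval T) (Set.Nonempty.mono
    (interior_maximal hsub isOpen_Ioo) (Set.nonempty_Ioo.2 ?_))
  exact_mod_cast hr

namespace IsStrongSolution

theorem isRegular (hu : IsStrongSolution n s T u) (hs : 5 / 2 < s) (ht : t ∈ timeInterval T) :
    IsRegular (u t) := by
  obtain ⟨F, -, hFu⟩ := hu.continuous_Hs.exists_eq_sobolevRep (by linarith) hu.continuous_space
  exact hFu t ht ▸ isRegular_sobolevRep hs (F t)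

theorem integrable_H2density (hu : IsStrongSolution n s T u) (hn : n ≠ 0) (hs : 5 / 2 < s)
    (ht : t ∈ timeInterval T) : Integrable (H2density n (u t)) :=
  ((hu.isRegular hs ht).integrable_comp_jet (contDiff_densityPoly n) (densityPoly_zero n)
    (fderiv_densityPoly_zero hn)).congr (.of_forall fun x => (H2density_eq_densityPoly n _ x).symm)

theorem hasWeakDeriv_velocity (hu : IsStrongSolution n s T u) (hn : n ≠ 0) (hs : 5 / 2 < s)
    (hT : 0 < T) (ht : t ∈ timeInterval T) {v : ℝ → ℝ} (hv : ContDiff ℝ 1 v)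
    (h : HasH1DerivWithinAt u v (timeInterval T) t) :
    HasWeakDeriv (deriv v - fun x =>
      (2 * n : ℝ)⁻¹ * eulerLagrange (densityPoly n) (jet (u t) x) (deriv (deriv (u t)) x)) v :=
    fun φ hφ hφc => by
  have hreg := hu.isRegular hs ht
  have hφ' : Continuous (deriv φ) := hφ.continuous_deriv (by simp)
  have hE := integrable_testFunction_smul hφ' hφc.deriv <|
    (continuous_eulerLagrange_jet hreg.contDiff (contDiff_densityPoly n)).const_mul (2 * n : ℝ)⁻¹
  have hφv := integrable_testFunction_smul hφ.continuous hφc hv.continuous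
  have hφv' := integrable_testFunction_smul hφ' hφc.deriv (hv.continuous_deriv le_rfl)
  have hmomentum := h.integral_momentum_mul ht (fun τ hτ => (hu.isRegular hs hτ).contDiff) hφ hφc
  have hequation := (uniqueDiffOn_timeInterval hT t ht).eq_deriv _ hmomentum
    (hu.equation t ht φ hφ hφc)
  rw [flux_eq_integral_eulerLagrange hreg.contDiff hn hφ hφc] at hequation
  simp only [smul_eq_mul] at hE hφv hφv'
  rw [integral_add hφv hφv'] at hequation
  simp only [smul_eq_mul, Pi.sub_apply, mul_sub]
  rw [integral_sub hφv' hE]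
  linarith

theorem hasDerivWithinAt_H2 (hu : IsStrongSolution n s T u) (hn : n ≠ 0) (hs : 5 / 2 < s)
    (hT : 0 < T) (ht : t ∈ timeInterval T) :
    HasDerivWithinAt (fun τ => H2 n (u τ)) 0 (timeInterval T) t := by
  have hreg := hu.isRegular hs ht
  have hL := contDiff_densityPoly n
  have hL' := fderiv_densityPoly_zero hn
  have hσ : 3 / 2 < s - 1 := by linarith
  obtain ⟨v, hv, hv₂, hder⟩ :=
    hu.contDiff_Hs_sub_one.exists_hasH1DerivWithinAt hσ hu.continuous_space ht
  obtain ⟨R, hR⟩ :=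
    hu.contDiff_Hs_sub_one.exists_eventually_norm_jet_le hσ hu.continuous_space ht
  have hzero := integral_mul_eq_zero_of_hasWeakDeriv hv
    ((continuous_eulerLagrange_jet hreg.contDiff hL).const_mul (2 * n : ℝ)⁻¹) hv₂.fst hv₂.snd
    ((hreg.memLp_eulerLagrange hL hL').const_mul (2 * n : ℝ)⁻¹)
    (hu.hasWeakDeriv_velocity hn hs hT ht hv hder)
  have hvariation : ∫ x, fderiv ℝ (densityPoly n) (jet (u t) x) (jet v x) = 0 := by
    rw [hreg.integral_fderiv_jet hL hL' (hv.differentiable one_ne_zero) hv₂]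
    simpa only [mul_assoc, integral_const_mul, mul_eq_zero, inv_eq_zero, OfNat.ofNat_ne_zero,
      Nat.cast_eq_zero, hn, false_or] using hzero
  have hcomp := hder.integral_comp ht hL (densityPoly_zero n) hL' hR
  rw [hvariation] at hcomp
  simpa only [H2, H2density_eq_densityPoly] using hcomp

end IsStrongSolution

end StrongSolution

end HOCH

end

theorem mainTheorem4 (n : ℕ) (hn : 1 ≤ n) (s : ℝ) (hs : 5 / 2 < s) (T : EReal) (hT : 0 < T)
    (u : ℝ → ℝ → ℝ) (hu : HOCH.IsStrongSolution n s T u) :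
    ∀ t ∈ HOCH.timeInterval T,
      MeasureTheory.Integrable (HOCH.H2density n (u t)) MeasureTheory.volume ∧
        HOCH.H2 n (u t) = HOCH.H2 n (u 0) := by
  have hn₀ : n ≠ 0 := Nat.one_le_iff_ne_zero.1 hn
  intro t ht
  refine ⟨hu.integrable_H2density hn₀ hs ht, ?_⟩
  have hconst := (HOCH.convex_timeInterval T).norm_image_sub_le_of_norm_hasDerivWithin_le (C := 0)
    (fun τ hτ => hu.hasDerivWithinAt_H2 hn₀ hs hT hτ) (fun _ _ => norm_zero.le)
    (HOCH.zero_mem_timeInterval hT) ht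
  rwa [zero_mul, norm_le_zero_iff, sub_eq_zero] at hconst
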